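/- Let $P=\mathbb{N}^{\mathrm{op}}$ be the set of natural numbers (including $0$) with the opposite of its usual order, regarded as a category with a unique morphism $p\to q$ whenever $p\le q$ in $P$. Let $X$ be the set of filters on $P$ (nonempty, upwards closed, downwards directed subsets), ordered by inclusion and equipped with the Scott topology. Then: 1. $X\cong\mathbb{N}\cup\{\infty\}$ as ordered sets (with the usual order on the right), the principal filter generated by $n$ corresponding to $n$, and the unique non-principal filter, which is $P$ itself, corresponding to $\infty$. 2. $|X| = |P| = \mathbf{cl} = \aleph_0$, where $\mathbf{cl}$ is the number of Grothendieck topologies $J$ on $P$ for which $\mathsf{Sh}(P,J)$ is a closed subtopos of $\mathsf{PSh}(P)$ (that is, for some subterminal presheaf $U$, the $J$-sheaves are exactly the presheaves $F$ for which the projection $F\times U\to U$ is an isomorphism). 3. $\mathbf{gt}=\mathbf{ep}=\mathbf{coh}=2^{\aleph_0}$, where $\mathbf{gt}$ is the cardinality of the set of all Grothendieck topologies on $P$; $\mathbf{ep}$ that of the set of those $J$ for which $\mathsf{Sh}(P,J)$ has enough points; and $\mathbf{coh}$ that of the set of those $J$ for which $\mathsf{Sh}(P,J)$ is a coherent subtopos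 of $\mathsf{PSh}(P)$. Here an object of a topos is compact if every epimorphic family onto it contains a finite epimorphic subfamily, and coherent if it is compact and every pullback over it of two compact objects is compact; a topos is coherent if it has a full subcategory of compact generators closed under finite limits; and $\mathsf{Sh}(P,J)$ is a coherent subtopos if $\mathsf{PSh}(P)$ and $\mathsf{Sh}(P,J)$ are coherent toposes and sheafification $\mathsf{PSh}(P)\to\mathsf{Sh}(P,J)$ preserves coherent objects. 4. $X$ is a spectral space, every open subset of $X$ is compact, and the patch topology on $X$ (generated by the compact open sets and their complements) coincides with the strong topology (generated by the locally closed sets). -/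

import Mathlib

open CategoryTheory CategoryTheory.Limits Cardinal

universe v u

namespace PosetTopos

/-! ### The dcpo of filters and its topologies -/

/-- The poset of filters on `P` (ordered by inclusion) carries the Scott topology. -/
instance filterScottTopology (P : Type u) [PartialOrder P] :
    TopologicalSpace (Order.PFilter P) :=
  Topology.scott (Order.PFilter P) Set.univ

/-- The strong topology on a topological space: the topology generated by the locally closed
sets, i.e. the intersections of an open and a closed set. -/
@[reducible]
def strongTopology (X : Type u) [TopologicalSpace X] : TopologicalSpace X :=
  TopologicalSpace.generateFrom {s : Set X | IsLocallyClosed s}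

/-- The patch topology on a topological space: the topology generated by the compact open sets
and their complements. -/
@[reducible]
def patchTopology (X : Type u) [TopologicalSpace X] : TopologicalSpace X :=
  TopologicalSpace.generateFrom
    ({s : Set X | IsOpen s ∧ IsCompact s} ∪ {s : Set X | IsOpen sᶜ ∧ IsCompact sᶜ})

/-! ### Compact and coherent objects, coherent toposes -/

section Topos

variable {E : Type u} [Category.{v} E]

/-- A family of morphisms with common codomain `X` is epimorphic. -/
def EpimorphicFamily {X : E} {ι : Type v} {Y : ι → E} (f : ∀ i, Y i ⟶ X) : Prop :=
  ∀ ⦃Z : E⦄ (g h : X ⟶ Z), (∀ i, f i ≫ g = f i ≫ h) → g = h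

/-- An object `X` is compact if every epimorphic family with codomain `X` contains a finite
epimorphic subfamily. -/
def IsCompactObject (X : E) : Prop :=
  ∀ ⦃ι : Type v⦄ ⦃Y : ι → E⦄ (f : ∀ i, Y i ⟶ X), EpimorphicFamily f →
    ∃ s : Finset ι, EpimorphicFamily (fun i : {i : ι // i ∈ s} => f i.1)

/-- An object `X` is coherent if it is compact and every diagram `Y ⟶ X ⟵ Z` of compact objects
has a compact pullback. -/
def IsCoherentObject (X : E) : Prop :=
  IsCompactObject X ∧
    ∀ ⦃W Y Z : E⦄ (fst : W ⟶ Y) (snd : W ⟶ Z) (f : Y ⟶ X) (g : Z ⟶ X),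
      IsPullback fst snd f g → IsCompactObject Y → IsCompactObject Z → IsCompactObject W

variable (E) in
/-- A topos is coherent if it contains a full subcategory of compact generators that is closed
under finite limits. -/
def IsCoherentTopos : Prop :=
  ∃ K : ObjectProperty E, (∀ X, K X → IsCompactObject X) ∧ K.IsSeparating ∧
    ∀ (D : Type) [SmallCategory D] [FinCategory D], K.IsClosedUnderLimitsOfShape D

end Topos

/-! ### Properties of the subtopos of presheaves given by a Grothendieck topology

The subtopos of the presheaf topos on `P` corresponding to a Grothendieck topology `J` is the
full subcategory of `J`-sheaves. -/

section Subtopos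

variable {P : Type u} [PartialOrder P]

/-- The topos of sheaves for `J` is a closed subtopos of the presheaf topos: there is a
subterminal presheaf `U` such that the sheaves are precisely the presheaves `F` for which the
projection `F ⨯ U ⟶ U` is an isomorphism. -/
def IsClosedSubtopos (J : GrothendieckTopology P) : Prop :=
  ∃ U : Pᵒᵖ ⥤ Type u, IsSubterminal U ∧
    ∀ F : Pᵒᵖ ⥤ Type u, Presheaf.IsSheaf J F ↔ IsIso (prod.snd : F ⨯ U ⟶ U)

/-- The topos of sheaves for `J` is a coherent subtopos of the presheaf topos: both toposes are
coherent, and the inverse image functor of the inclusion (sheafification) preserves coherent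
objects. -/
def IsCoherentSubtopos (J : GrothendieckTopology P) : Prop :=
  IsCoherentTopos (Pᵒᵖ ⥤ Type u) ∧ IsCoherentTopos (Sheaf J (Type u)) ∧
    ∀ F : Pᵒᵖ ⥤ Type u, IsCoherentObject F →
      IsCoherentObject ((presheafToSheaf J (Type u)).obj F)

end Subtopos

/-! ### The cardinalities attached to a poset `P` -/

section Cardinalities

variable (P : Type u) [PartialOrder P]

/-- Cardinality of the set of closed subtoposes. -/
noncomputable def cl : Cardinal.{u} := #{J : GrothendieckTopology P // IsClosedSubtopos J}

/-- Cardinality of the set of coherent subtoposes. -/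
noncomputable def coh : Cardinal.{u} := #{J : GrothendieckTopology P // IsCoherentSubtopos J}

/-- Cardinality of the set of subtoposes with enough points. -/
noncomputable def ep : Cardinal.{u} :=
  #{J : GrothendieckTopology P // GrothendieckTopology.HasEnoughPoints.{u} J}

/-- Cardinality of the set of Grothendieck topologies. -/
noncomputable def gt : Cardinal.{u} := #(GrothendieckTopology P)

end Cardinalities

end PosetTopos

/-! Filters on `ℕᵒᵈ` are the nonempty initial segments of `ℕ`, which gives `ℕ∞`. A nonempty Scott
open set is the set of filters above some finite `n` (`isOpen_filter`). It has a least element, so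
it is compact; spectrality and the agreement of patch and strong topologies follow.

Sieves on `ℕᵒᵈ` are countable in number, so there are at most `2 ^ ℵ₀` topologies. For the lower
bounds, each `S : Set ℕ` yields `subsetTopology S`, injectively, and the elements of `S` supply
enough points. If `S` is infinite it is the range of an order embedding `s`. Sheaves are then
equivalent to presheaves on `ℕᵒᵈ`, and sheafification becomes restriction along `s`. Compact
presheaves are those with finite values and eventually bijective transitions
(`isCompactObject_iff_isFiniteStable`), a condition stable under finite limits and under
restriction, so the subtopos is coherent.

A closed subtopos is determined by the support of `U`, one of countably many upper sets of `ℕ`; the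
sets `Set.Iio n` give infinitely many. -/

namespace PosetTopos

/-! ### Filters on the natural numbers with the opposite order -/

section Filters

open Order OrderDual

/-- The filter on `ℕᵒᵈ` of all natural numbers below an extended natural number. -/
def filterOfENat (k : ℕ∞) : PFilter ℕᵒᵈ :=
  IsPFilter.toPFilter (F := {m | ((ofDual m : ℕ) : ℕ∞) ≤ k}) <|
    IsPFilter.of_def ⟨toDual 0, by simp⟩
      (fun a ha b hb => (le_total a b).elim (fun h => ⟨a, ha, le_refl a, h⟩)
        fun h => ⟨b, hb, h, le_refl b⟩)
      (fun {x y} hxy hx => show ((ofDual y : ℕ) : ℕ∞) ≤ k from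
        le_trans (Nat.cast_le.2 (show ofDual y ≤ ofDual x from hxy)) hx)

theorem mem_filterOfENat {k : ℕ∞} {m : ℕ} : toDual m ∈ filterOfENat k ↔ (m : ℕ∞) ≤ k :=
  Iff.rfl

theorem filterOfENat_le_iff {k l : ℕ∞} : filterOfENat k ≤ filterOfENat l ↔ k ≤ l := by
  refine ⟨fun h => ?_, fun h m hm => le_trans hm h⟩
  refine ENat.forall_natCast_le_iff_le.1 fun m hm => ?_
  exact mem_filterOfENat.1 (h (mem_filterOfENat.2 hm))

theorem filterOfENat_natCast (n : ℕ) : filterOfENat n = PFilter.principal (toDual n) := by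
  refine PFilter.ext _ _ (Set.ext fun m => ?_)
  exact (Nat.cast_le : ((ofDual m : ℕ) : ℕ∞) ≤ n ↔ _)

theorem coe_filterOfENat_top : (filterOfENat ⊤ : Set ℕᵒᵈ) = Set.univ :=
  Set.eq_univ_of_forall fun _ => le_top (α := ℕ∞)

theorem filterOfENat_surjective : Function.Surjective filterOfENat := by
  intro F
  by_cases h : ∀ m, toDual m ∈ F
  · refine ⟨⊤, PFilter.ext _ _ ?_⟩
    rw [coe_filterOfENat_top]
    exact (Set.eq_univ_of_forall h).symm
  · push Not at h
    classical
    -- `0` is the top of `ℕᵒᵈ`, so it lies in every filter; hence the least missing number has a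
    -- predecessor.
    have hpos : Nat.find h ≠ 0 := by
      intro h0
      obtain ⟨x, hx⟩ := F.nonempty
      exact Nat.find_spec h (PFilter.mem_of_le (x := x) (by rw [h0]; exact Nat.zero_le (ofDual x)) hx)
    refine ⟨(Nat.find h - 1 : ℕ), ?_⟩
    rw [filterOfENat_natCast]
    refine PFilter.ext _ _ (Set.ext fun m => ?_)
    change ofDual m ≤ Nat.find h - 1 ↔ m ∈ F
    constructor
    · intro hm
      exact not_not.1 (Nat.find_min h (show ofDual m < Nat.find h by omega))
    · intro hm
      by_contra hlt
      exact Nat.find_spec h (PFilter.mem_of_le (x := m)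
        (show Nat.find h ≤ ofDual m by omega) hm)

/-- The poset of filters on `ℕᵒᵈ` is isomorphic to `ℕ∞`. -/
noncomputable def filterOrderIso : PFilter ℕᵒᵈ ≃o ℕ∞ :=
  (RelIso.ofSurjective (OrderEmbedding.ofMapLEIff filterOfENat fun _ _ => filterOfENat_le_iff)
    filterOfENat_surjective).symm

theorem filterOrderIso_symm_apply (k : ℕ∞) : filterOrderIso.symm k = filterOfENat k := rfl

instance : Topology.IsScott (PFilter ℕᵒᵈ) Set.univ := ⟨rfl⟩

/-- The top filter is the directed supremum of the principal ones, so a nonempty Scott open set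
contains a principal filter; the least such `n` generates it. -/
theorem isOpen_filter {U : Set (PFilter ℕᵒᵈ)} (hU : IsOpen U) :
    U = ∅ ∨ ∃ n : ℕ, U = Set.Ici (filterOfENat n) := by
  obtain ⟨hup, hdir⟩ :=
    (Topology.IsScott.isOpen_iff_isUpperSet_and_dirSupInaccOn (D := Set.univ)).1 hU
  refine U.eq_empty_or_nonempty.imp id fun ⟨F, hF⟩ => ?_
  have hfin : ∃ n : ℕ, filterOfENat n ∈ U := by
    have htop : filterOfENat ⊤ ∈ U := by
      obtain ⟨k, rfl⟩ := filterOfENat_surjective F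
      exact hup (filterOfENat_le_iff.2 le_top) hF
    obtain ⟨_, ⟨n, rfl⟩, hn⟩ := hdir (Set.mem_univ (Set.range fun n : ℕ => filterOfENat n))
      (Set.range_nonempty _)
      (directedOn_range.2 <| directed_of_isDirected_le fun m n hmn =>
        filterOfENat_le_iff.2 (Nat.cast_le.2 hmn))
      (a := filterOfENat ⊤) ⟨by
        rintro _ ⟨n, rfl⟩
        exact filterOfENat_le_iff.2 le_top, fun G hG m _ =>
          hG (Set.mem_range_self (ofDual m)) (mem_filterOfENat.2 le_rfl)⟩ htop
    exact ⟨n, hn⟩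
  classical
  refine ⟨Nat.find hfin, Set.Subset.antisymm (fun G hG => ?_) fun G hG =>
    hup hG (Nat.find_spec hfin)⟩
  obtain ⟨k, rfl⟩ := filterOfENat_surjective G
  refine filterOfENat_le_iff.2 ?_
  induction k with
  | top => exact le_top
  | coe k => exact Nat.cast_le.2 (Nat.find_min' hfin hG)

theorem isCompact_of_isOpen_filter {U : Set (PFilter ℕᵒᵈ)} (hU : IsOpen U) : IsCompact U := by
  obtain rfl | ⟨n, rfl⟩ := isOpen_filter hU
  · exact isCompact_empty
  · refine isCompact_of_finite_subcover fun {ι} V hV hsub => ?_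
    obtain ⟨i, hi⟩ := Set.mem_iUnion.1 (hsub Set.self_mem_Ici)
    refine ⟨{i}, fun G hG => ?_⟩
    simpa using Topology.IsScott.isUpperSet_of_isOpen (D := Set.univ) (hV i) hG hi

instance : SpectralSpace (PFilter ℕᵒᵈ) where
  isCompact_univ := isCompact_of_isOpen_filter isOpen_univ
  inter_isCompact _ _ hU _ hV _ := isCompact_of_isOpen_filter (hU.inter hV)
  isTopologicalBasis := by
    convert! TopologicalSpace.isTopologicalBasis_opens using 2
    ext U
    exact ⟨fun h => h.1, fun h => ⟨h, isCompact_of_isOpen_filter h⟩⟩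
  sober := by
    intro S hirr hS
    have key : ∃ k, S = Set.Iic (filterOfENat k) := by
      obtain h | ⟨n, h⟩ := isOpen_filter hS.isOpen_compl
      · refine ⟨⊤, ?_⟩
        rw [Set.compl_empty_iff.1 h]
        refine (Set.eq_univ_of_forall fun F => ?_).symm
        obtain ⟨k, rfl⟩ := filterOfENat_surjective F
        exact filterOfENat_le_iff.2 le_top
      · have hS' : ∀ k, filterOfENat k ∈ S ↔ k < n := fun k => by
          rw [← not_iff_not, ← Set.mem_compl_iff, h, not_lt]
          exact filterOfENat_le_iff
        cases n with
        -- Here the closed set would be empty, which irreducibility excludes.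
        | zero =>
          obtain ⟨F, hF⟩ := hirr.nonempty
          obtain ⟨k, rfl⟩ := filterOfENat_surjective F
          exact absurd ((hS' k).1 hF) (by simp)
        | succ n =>
          refine ⟨n, Set.ext fun F => ?_⟩
          obtain ⟨k, rfl⟩ := filterOfENat_surjective F
          rw [hS', Set.mem_Iic, filterOfENat_le_iff]
          push_cast
          exact ENat.lt_natCast_add_one_iff
    obtain ⟨k, rfl⟩ := key
    exact ⟨_, Topology.IsScott.closure_singleton⟩

theorem patchTopology_filter :
    patchTopology (PFilter ℕᵒᵈ) = strongTopology (PFilter ℕᵒᵈ) := by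
  refine le_antisymm (le_generateFrom ?_) (le_generateFrom ?_)
  · rintro _ ⟨U, Z, hU, hZ, rfl⟩
    refine @IsOpen.inter _ (patchTopology (PFilter ℕᵒᵈ)) _ _ ?_ ?_
    · exact .basic _ (.inl ⟨hU, isCompact_of_isOpen_filter hU⟩)
    · exact .basic _ (.inr ⟨hZ.isOpen_compl, isCompact_of_isOpen_filter hZ.isOpen_compl⟩)
  · rintro s (h | h)
    · exact .basic _ h.1.isLocallyClosed
    · exact .basic _ (isOpen_compl_iff.1 h.1).isLocallyClosed

end Filters

/-! ### Compact objects and equivalences of categories -/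

section Transfer

universe u'

variable {E : Type u} [Category.{v} E] {E' : Type u'} [Category.{v} E']

theorem IsCompactObject.of_iso {X Y : E} (e : X ≅ Y) (hX : IsCompactObject X) :
    IsCompactObject Y := by
  intro ι Z f hf
  obtain ⟨s, hs⟩ := hX (fun i => f i ≫ e.inv) fun W g h hgh => by
    have := hf (e.inv ≫ g) (e.inv ≫ h) fun i => by simpa using hgh i
    simpa using this
  refine ⟨s, fun W g h hgh => ?_⟩
  have := hs (e.hom ≫ g) (e.hom ≫ h) fun i => by simpa using hgh i
  simpa using this

theorem epimorphicFamily_map_iff (F : E ⥤ E') [F.IsEquivalence] {X : E} {ι : Type v} {Y : ι → E}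
    (f : ∀ i, Y i ⟶ X) : EpimorphicFamily (fun i => F.map (f i)) ↔ EpimorphicFamily f := by
  constructor
  · intro H Z g h hgh
    exact F.map_injective (H _ _ fun i => by rw [← F.map_comp, ← F.map_comp, hgh])
  · intro H Z g h hgh
    let e := F.objObjPreimageIso Z
    obtain ⟨g', hg⟩ := F.map_surjective (g ≫ e.inv)
    obtain ⟨h', hh⟩ := F.map_surjective (h ≫ e.inv)
    have := H g' h' fun i => F.map_injective (by
      rw [F.map_comp, F.map_comp, hg, hh, ← Category.assoc, hgh, Category.assoc])
    rw [← cancel_mono e.inv, ← hg, ← hh, this]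

theorem IsCompactObject.of_map (F : E ⥤ E') [F.IsEquivalence] {X : E}
    (hX : IsCompactObject (F.obj X)) : IsCompactObject X := by
  intro ι Y f hf
  obtain ⟨s, hs⟩ := hX _ ((epimorphicFamily_map_iff F f).2 hf)
  exact ⟨s, (epimorphicFamily_map_iff F fun i : {i : ι // i ∈ s} => f i.1).1 hs⟩

theorem isCompactObject_map_iff (F : E ⥤ E') [F.IsEquivalence] {X : E} :
    IsCompactObject (F.obj X) ↔ IsCompactObject X :=
  ⟨.of_map F, fun hX => .of_map F.inv (hX.of_iso (F.asEquivalence.unitIso.app X))⟩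

theorem isCoherentTopos_of_isEquivalence (F : E ⥤ E') [F.IsEquivalence]
    (hsep : ObjectProperty.IsSeparating (IsCompactObject (E := E')))
    (hlim : ∀ (D : Type) [SmallCategory D] [FinCategory D],
      ObjectProperty.IsClosedUnderLimitsOfShape (IsCompactObject (E := E')) D) :
    IsCoherentTopos E := by
  refine ⟨ObjectProperty.inverseImage IsCompactObject F, fun X hX => .of_map F hX,
    fun X Y f g h => F.map_injective (hsep _ _ fun G hG a => ?_), fun D _ _ => ?_⟩
  · let e := F.objObjPreimageIso G
    obtain ⟨b, hb⟩ := F.map_surjective (e.hom ≫ a)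
    have := congrArg F.map (h _ (hG.of_iso e.symm) b)
    rwa [F.map_comp, F.map_comp, hb, Category.assoc, Category.assoc, cancel_epi] at this
  · have := hlim D
    infer_instance

/-- When compact objects are closed under pullbacks, the second half of coherence is automatic. -/
theorem isCoherentObject_iff_of_isEquivalence (F : E ⥤ E') [F.IsEquivalence]
    [ObjectProperty.IsClosedUnderLimitsOfShape (IsCompactObject (E := E')) WalkingCospan] {X : E} :
    IsCoherentObject X ↔ IsCompactObject (F.obj X) := by
  rw [isCompactObject_map_iff]
  refine ⟨fun h => h.1, fun h => ⟨h, fun W Y Z fst snd f g sq hY hZ => ?_⟩⟩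
  rw [← isCompactObject_map_iff F] at h hY hZ ⊢
  refine ObjectProperty.prop_of_isLimit _ (sq.map F).isLimit ?_
  rintro (_ | _ | _)
  exacts [h, hY, hZ]

end Transfer

/-! ### Compact presheaves on `ℕᵒᵈ` -/

section Presheaves

open Opposite OrderDual

theorem epimorphicFamily_iff_jointly_surjective {C : Type v} [SmallCategory C]
    {X : Cᵒᵖ ⥤ Type v} {ι : Type v} {Y : ι → Cᵒᵖ ⥤ Type v} (f : ∀ i, Y i ⟶ X) :
    EpimorphicFamily f ↔ ∀ (p : Cᵒᵖ) (x : X.obj p), ∃ (i : ι) (y : (Y i).obj p),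
      (f i).app p y = x := by
  constructor
  · intro H p x
    have : Epi (Sigma.desc f) := ⟨fun g h hgh => H _ _ fun i => by
      simpa using congrArg (Sigma.ι Y i ≫ ·) hgh⟩
    obtain ⟨z, rfl⟩ := (epi_iff_surjective _).1 ((NatTrans.epi_iff_epi_app _).1 this p) x
    obtain ⟨⟨i⟩, y, rfl⟩ := Types.jointly_surjective_of_isColimit
      (isColimitOfPreserves ((evaluation _ _).obj p) (coproductIsCoproduct Y)) z
    refine ⟨i, y, ?_⟩
    have := ConcreteCategory.congr_hom (NatTrans.congr_app (Sigma.ι_desc f i) p) y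
    exact this.symm
  · intro H Z g h hgh
    ext p x
    obtain ⟨i, y, rfl⟩ := H p x
    exact ConcreteCategory.congr_hom (NatTrans.congr_app (hgh i) p) y

/-- The transition map of a presheaf on `ℕᵒᵈ`. -/
def transition (F : ℕᵒᵈᵒᵖ ⥤ Type) {m n : ℕ} (h : m ≤ n) :
    F.obj (op (toDual m)) ⟶ F.obj (op (toDual n)) :=
  F.map (homOfLE (toDual_le_toDual.2 h)).op

theorem transition_transition (F : ℕᵒᵈᵒᵖ ⥤ Type) {k m n : ℕ} (h : k ≤ m) (h' : m ≤ n)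
    (x : F.obj (op (toDual k))) :
    transition F h' (transition F h x) = transition F (h.trans h') x :=
  (ConcreteCategory.congr_hom (F.map_comp _ _) x).symm

theorem transition_naturality {F G : ℕᵒᵈᵒᵖ ⥤ Type} (f : F ⟶ G) {m n : ℕ} (h : m ≤ n)
    (x : F.obj (op (toDual m))) :
    f.app _ (transition F h x) = transition G h (f.app _ x) :=
  ConcreteCategory.congr_hom (f.naturality _) x

/-- A presheaf on `ℕᵒᵈ` is finite and stabilizes if its values are finite and its transition maps
are eventually bijective. -/
def IsFiniteStable (F : ℕᵒᵈᵒᵖ ⥤ Type) : Prop :=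
  (∀ n, Finite (F.obj (op (toDual n)))) ∧
    ∃ N, ∀ ⦃m n : ℕ⦄ (h : m ≤ n), N ≤ m → Function.Bijective (transition F h)

/-- It suffices to hit the finitely many elements in degrees at most `N`: every later element is
transported from degree `N`. -/
theorem IsFiniteStable.isCompactObject {F : ℕᵒᵈᵒᵖ ⥤ Type} (hF : IsFiniteStable F) :
    IsCompactObject F := by
  obtain ⟨hfin, N, hN⟩ := hF
  intro ι Y f hf
  rw [epimorphicFamily_iff_jointly_surjective] at hf
  classical
  choose i y hy using hf
  let T := Σ n : Fin (N + 1), F.obj (op (toDual (n : ℕ)))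
  have : Finite T := inferInstance
  have := Fintype.ofFinite T
  refine ⟨Finset.univ.image fun t : T => i _ t.2, ?_⟩
  rw [epimorphicFamily_iff_jointly_surjective]
  have key (n : ℕ) (hn : n ≤ N) (x : F.obj (op (toDual n))) :
      i _ x ∈ Finset.univ.image fun t : T => i _ t.2 :=
    Finset.mem_image.2 ⟨⟨⟨n, by omega⟩, x⟩, Finset.mem_univ _, rfl⟩
  rintro ⟨n⟩ x
  change ℕ at n
  obtain hn | hn := le_total n N
  · exact ⟨⟨_, key n hn x⟩, y _ x, hy _ x⟩
  · obtain ⟨x, rfl⟩ := (hN hn le_rfl).2 x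
    refine ⟨⟨_, key N le_rfl x⟩, transition _ hn (y _ x), ?_⟩
    exact (transition_naturality _ _ _).trans (congrArg _ (hy _ x))

/-- Compactness is applied to the cover by all elements, seen as maps from representables. Finitely
many elements generate `F`, so values are finite and transitions beyond the largest generating
degree are surjective. Cardinalities then decrease and stabilize, forcing bijectivity. -/
theorem IsCompactObject.isFiniteStable {F : ℕᵒᵈᵒᵖ ⥤ Type} (hF : IsCompactObject F) :
    IsFiniteStable F := by
  let ι : Type := Σ n : ℕ, F.obj (op (toDual n))
  obtain ⟨s, hs⟩ := hF (ι := ι) (Y := fun i => yoneda.obj (toDual i.1))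
    (fun i => yonedaEquiv.symm i.2) (by
      rw [epimorphicFamily_iff_jointly_surjective]
      rintro ⟨n⟩ x
      exact ⟨⟨ofDual n, x⟩, 𝟙 _, yonedaEquiv.apply_symm_apply x⟩)
  rw [epimorphicFamily_iff_jointly_surjective] at hs
  have key (n : ℕ) (x : F.obj (op (toDual n))) :
      ∃ i ∈ s, ∃ h : i.1 ≤ n, transition F h i.2 = x := by
    obtain ⟨⟨i, hi⟩, y, hy⟩ := hs _ x
    exact ⟨i, hi, leOfHom y, hy⟩
  have hfin (n : ℕ) : Finite (F.obj (op (toDual n))) := by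
    choose i hi h hx using key n
    refine Finite.of_injective (fun x => (⟨i x, hi x⟩ : s)) fun x y hxy => ?_
    have aux : ∀ (a b : ι) (ha : a.1 ≤ n) (hb : b.1 ≤ n), a = b →
        transition F ha a.2 = transition F hb b.2 := by
      rintro a _ _ _ rfl
      rfl
    rw [← hx x, ← hx y]
    exact aux _ _ _ _ (congrArg Subtype.val hxy)
  have hsurj {m n : ℕ} (h : m ≤ n) (hm : s.sup Sigma.fst ≤ m) :
      Function.Surjective (transition F h) := by
    intro x
    obtain ⟨i, hi, hin, rfl⟩ := key n x
    exact ⟨transition F ((Finset.le_sup (f := Sigma.fst) hi).trans hm) i.2,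
      transition_transition _ _ _ _⟩
  let N := s.sup Sigma.fst
  let c : ℕ → ℕ := fun n => Nat.card (F.obj (op (toDual (N + n))))
  have hc : Antitone c := fun m n hmn =>
    Nat.card_le_card_of_surjective _ (hsurj (Nat.add_le_add_left hmn N) (Nat.le_add_right _ _))
  obtain ⟨M, hM⟩ := WellFoundedLT.antitone_chain_condition hc
  refine ⟨hfin, N + M, fun m n h hm => ?_⟩
  obtain ⟨a, rfl⟩ := Nat.exists_eq_add_of_le ((Nat.le_add_right N M).trans hm)
  obtain ⟨b, rfl⟩ := Nat.exists_eq_add_of_le ((Nat.le_add_right N a).trans h)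
  have := hfin (N + a)
  exact (Nat.bijective_iff_surjective_and_card _).2 ⟨hsurj h (Nat.le_add_right _ _),
    (hM a (by omega)).symm.trans (hM b (by omega))⟩

theorem isFiniteStable_of_isLimit {D : Type} [SmallCategory D] [FinCategory D]
    {K : D ⥤ ℕᵒᵈᵒᵖ ⥤ Type} {c : Cone K} (hc : IsLimit c) (hK : ∀ j, IsFiniteStable (K.obj j)) :
    IsFiniteStable c.pt := by
  have hev (n : ℕ) : IsLimit (((evaluation _ _).obj (op (toDual n))).mapCone c) :=
    isLimitOfPreserves _ hc
  have hext (n : ℕ) (x y : c.pt.obj (op (toDual n)))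
      (h : ∀ j, (c.π.app j).app _ x = (c.π.app j).app _ y) : x = y :=
    (Types.isLimitEquivSections (hev n)).injective (Subtype.ext (funext h))
  refine ⟨fun n => ?_, ?_⟩
  · have (j : D) := (hK j).1 n
    exact Finite.of_injective (fun x j => (c.π.app j).app _ x) fun x y h => hext n x y (congrFun h)
  · choose N hN using fun j => (hK j).2
    refine ⟨Finset.univ.sup N, fun m n h hm => ?_⟩
    replace hN (j : D) : Function.Bijective (transition (K.obj j) h) :=
      hN j h ((Finset.le_sup (Finset.mem_univ j)).trans hm)
    have hπ (j : D) (x : c.pt.obj (op (toDual m))) :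
        (c.π.app j).app _ (transition c.pt h x) = transition (K.obj j) h ((c.π.app j).app _ x) :=
      transition_naturality (c.π.app j) h x
    constructor
    · intro x y hxy
      refine hext m x y fun j => (hN j).1 ?_
      rw [← hπ, ← hπ, hxy]
    · intro y
      choose x hx using fun j => (hN j).2 ((c.π.app j).app _ y)
      -- The coordinatewise preimages are compatible because they become so after an injective
      -- transition.
      have hsec {i j : D} (a : i ⟶ j) : (K.map a).app _ (x i) = x j := (hN j).1 <| by
        rw [← transition_naturality (K.map a) h (x i), hx, hx]
        exact ConcreteCategory.congr_hom (NatTrans.congr_app (c.w a) _) y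
      obtain ⟨z, hz⟩ := (Types.isLimitEquivSections (hev m)).surjective ⟨x, hsec⟩
      refine ⟨z, hext n _ _ fun j => ?_⟩
      rw [hπ, ← hx]
      exact congrArg _ (congrFun (congrArg Subtype.val hz) j)

theorem isCompactObject_iff_isFiniteStable {F : ℕᵒᵈᵒᵖ ⥤ Type} :
    IsCompactObject F ↔ IsFiniteStable F :=
  ⟨fun h => h.isFiniteStable, fun h => h.isCompactObject⟩

instance isClosedUnderLimitsOfShape_isCompactObject (D : Type) [SmallCategory D] [FinCategory D] :
    ObjectProperty.IsClosedUnderLimitsOfShape (IsCompactObject (E := ℕᵒᵈᵒᵖ ⥤ Type)) D where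
  limitsOfShape_le := by
    rintro X ⟨h⟩
    exact (isFiniteStable_of_isLimit h.isLimit
      fun j => (h.prop_diag_obj j).isFiniteStable).isCompactObject

theorem isFiniteStable_yoneda (n : ℕᵒᵈ) : IsFiniteStable (yoneda.obj n) := by
  have (m : ℕᵒᵈ) : Subsingleton ((yoneda.obj n).obj (op m)) :=
    inferInstanceAs (Subsingleton (m ⟶ n))
  exact ⟨fun m => inferInstance, ofDual n, fun m k h hm =>
    ⟨Function.injective_of_subsingleton _,
      fun y => ⟨homOfLE (toDual_le.2 hm), Subsingleton.elim _ _⟩⟩⟩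

theorem isSeparating_isCompactObject :
    ObjectProperty.IsSeparating (IsCompactObject (E := ℕᵒᵈᵒᵖ ⥤ Type)) := by
  intro X Y f g h
  ext ⟨n⟩ x
  have := congrArg yonedaEquiv
    (h _ (isFiniteStable_yoneda n).isCompactObject (yonedaEquiv.symm x))
  simpa [yonedaEquiv_comp] using this

end Presheaves

/-! ### The Grothendieck topology attached to a set of natural numbers -/

section SubsetTopology

open Opposite OrderDual

/-- The Grothendieck topology on `ℕᵒᵈ` attached to a set `S` of natural numbers: a sieve on `p` is
covering if it contains all elements of `S` below `p`. -/
def subsetTopology (S : Set ℕ) : GrothendieckTopology ℕᵒᵈ where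
  sieves p := {R | ∀ ⦃q : ℕᵒᵈ⦄ (f : q ⟶ p), ofDual q ∈ S → R f}
  top_mem' _ _ _ _ := trivial
  pullback_stable' _ _ _ f hR _ g hq := hR (g ≫ f) hq
  transitive' p R hR R' hR' q f hq := by
    simpa using hR' (hR f hq) (𝟙 q) hq

theorem mem_subsetTopology {S : Set ℕ} {p : ℕᵒᵈ} {R : Sieve p} :
    R ∈ subsetTopology S p ↔ ∀ ⦃q : ℕᵒᵈ⦄ (f : q ⟶ p), ofDual q ∈ S → R f :=
  Iff.rfl

theorem subsetTopology_injective : Function.Injective subsetTopology := by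
  intro S T h
  -- Membership of `n` is detected by the sieve on `n` omitting only `n` itself: it covers exactly
  -- when `n ∉ S`.
  ext n
  let R : Sieve (toDual n) :=
    { arrows := fun q _ => ofDual q ≠ n
      downward_closed := fun {q r} f hf g => by
        have h₁ : n ≤ ofDual q := leOfHom f
        have h₂ : ofDual q ≤ ofDual r := leOfHom g
        omega }
  have key (S : Set ℕ) : n ∈ S ↔ R ∉ subsetTopology S (toDual n) := by
    rw [mem_subsetTopology]
    refine ⟨fun hn hR => hR (𝟙 _) hn rfl, fun hR => ?_⟩
    by_contra hn
    exact hR fun q f hq hqn => hn (hqn ▸ hq)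
  rw [key, key, h]

/-- The point of the site defined by a set `S` of natural numbers given by an element of `S`. -/
noncomputable def subsetPoint {S : Set ℕ} (s : S) :
    GrothendieckTopology.Point.{0} (subsetTopology S) where
  fiber := shrinkYoneda.{0}.flip.obj (op (toDual s.1))
  jointly_surjective {U} R hR x := by
    obtain ⟨x, rfl⟩ := shrinkYonedaObjObjEquiv.symm.surjective x
    refine ⟨_, x, hR x s.2, shrinkYonedaObjObjEquiv.symm (𝟙 _),
      shrinkYonedaObjObjEquiv.injective (Subsingleton.elim _ _)⟩

instance (S : Set ℕ) : GrothendieckTopology.HasEnoughPoints.{0} (subsetTopology S) := by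
  refine ⟨.ofObj subsetPoint, inferInstance, .mk' fun X R hR => ?_⟩
  intro q f hq
  -- At the point given by `q`, the arrow `f` is an element of the fiber; lifting it means factoring
  -- it through an arrow of `R`.
  obtain ⟨Y, a, ha, b, hb⟩ := hR ⟨_, ⟨(⟨ofDual q, hq⟩ : S)⟩⟩ (shrinkYonedaObjObjEquiv.symm f)
  obtain ⟨b, rfl⟩ := shrinkYonedaObjObjEquiv.symm.surjective b
  exact R.downward_closed ha b

/-- The functor `ℕᵒᵈ ⥤ ℕᵒᵈ` induced by an order embedding `ℕ ↪o ℕ`. -/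
def orderEmbeddingFunctor (s : ℕ ↪o ℕ) : ℕᵒᵈ ⥤ ℕᵒᵈ := s.monotone.dual.functor

variable (s : ℕ ↪o ℕ)

instance : (orderEmbeddingFunctor s).Full where
  map_surjective f := ⟨homOfLE (s.le_iff_le.1 (leOfHom f)), Subsingleton.elim _ _⟩

instance : (orderEmbeddingFunctor s).Faithful where
  map_injective _ := Subsingleton.elim _ _

theorem hom_orderEmbeddingFunctor {p q : ℕᵒᵈ}
    (f : (orderEmbeddingFunctor s).obj p ⟶ (orderEmbeddingFunctor s).obj q) : p ≤ q :=
  s.le_iff_le.1 (leOfHom f)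

instance : (orderEmbeddingFunctor s).IsCoverDense (subsetTopology (Set.range s)) where
  is_cover p := by
    rintro q f ⟨n, hn⟩
    obtain rfl : (orderEmbeddingFunctor s).obj (toDual n) = q := congrArg toDual hn
    exact ⟨⟨_, 𝟙 _, f, by simp⟩⟩

instance : (orderEmbeddingFunctor s).IsDenseSubsite ⊥ (subsetTopology (Set.range s)) where
  functorPushforward_mem_iff {p R} := by
    rw [mem_subsetTopology, GrothendieckTopology.bot_covering, ← Sieve.id_mem_iff_eq_top]
    constructor
    · intro h
      obtain ⟨q, f, g, hf, -⟩ := h (𝟙 _) ⟨ofDual p, rfl⟩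
      rw [← Subsingleton.elim (homOfLE (hom_orderEmbeddingFunctor s g) ≫ f) (𝟙 p)]
      exact R.downward_closed hf _
    · rintro h q f -
      exact ⟨p, 𝟙 _, f, h, by simp⟩

/-- Sheaves for the topology attached to the range of `s` are equivalent to presheaves, by
restriction along `s`. -/
noncomputable def sheafRestriction :
    Sheaf (subsetTopology (Set.range s)) Type ⥤ (ℕᵒᵈᵒᵖ ⥤ Type) :=
  (orderEmbeddingFunctor s).sheafPushforwardContinuous Type ⊥ (subsetTopology (Set.range s)) ⋙
    sheafToPresheaf ⊥ Type

instance : (sheafToPresheaf (⊥ : GrothendieckTopology ℕᵒᵈ) Type).IsEquivalence :=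
  inferInstanceAs (sheafBotEquivalence _).functor.IsEquivalence

instance : (sheafRestriction s).IsEquivalence := by
  unfold sheafRestriction
  infer_instance

/-- The restriction of the sheafification of a presheaf along `s` is its restriction along `s`. -/
noncomputable def sheafRestrictionSheafificationIso (F : ℕᵒᵈᵒᵖ ⥤ Type) :
    (sheafRestriction s).obj ((presheafToSheaf (subsetTopology (Set.range s)) Type).obj F) ≅
      (orderEmbeddingFunctor s).op ⋙ F :=
  (sheafToPresheaf ⊥ Type).mapIso
    ((Functor.IsDenseSubsite.sheafEquivSheafificationCompatibility ⊥ (subsetTopology (Set.range s))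
      (orderEmbeddingFunctor s) Type).app F).symm ≪≫
    (isoSheafify ⊥ (Presheaf.isSheaf_bot ((orderEmbeddingFunctor s).op ⋙ F))).symm

theorem IsFiniteStable.comp {F : ℕᵒᵈᵒᵖ ⥤ Type} (hF : IsFiniteStable F) :
    IsFiniteStable ((orderEmbeddingFunctor s).op ⋙ F) := by
  obtain ⟨hfin, N, hN⟩ := hF
  exact ⟨fun n => hfin (s n), N, fun m n h hm =>
    hN (s.monotone h) (hm.trans (s.strictMono.le_apply))⟩

theorem isCoherentSubtopos_subsetTopology {S : Set ℕ} (hS : S.Infinite) :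
    IsCoherentSubtopos (subsetTopology S) := by
  classical
  have := hS.to_subtype
  obtain ⟨s, rfl⟩ : ∃ s : ℕ ↪o ℕ, Set.range s = S := ⟨_, Nat.orderEmbeddingOfSet_range S⟩
  refine ⟨isCoherentTopos_of_isEquivalence (𝟭 _) isSeparating_isCompactObject
      fun _ _ _ => inferInstance,
    isCoherentTopos_of_isEquivalence (sheafRestriction s) isSeparating_isCompactObject
      fun _ _ _ => inferInstance, fun F hF => ?_⟩
  rw [isCoherentObject_iff_of_isEquivalence (sheafRestriction s)]
  exact hF.1.isFiniteStable.comp s |>.isCompactObject.of_iso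
    (sheafRestrictionSheafificationIso s F).symm

end SubsetTopology

/-! ### Cardinalities -/

section Cardinality

open Opposite OrderDual

theorem countable_upperSet_nat : Countable (UpperSet ℕ) := by
  classical
  refine Function.Surjective.countable (α := ℕ∞) (f := fun k => ⟨{m : ℕ | k ≤ m}, fun a b h ha =>
    show k ≤ b from le_trans ha (Nat.cast_le.2 h)⟩) fun A => ?_
  by_cases h : ∃ n, n ∈ A
  · refine ⟨(Nat.find h : ℕ), SetLike.ext fun m => ?_⟩
    change ((Nat.find h : ℕ) : ℕ∞) ≤ (m : ℕ∞) ↔ m ∈ A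
    rw [Nat.cast_le]
    exact ⟨fun hm => A.upper hm (Nat.find_spec h), fun hm => Nat.find_min' h hm⟩
  · refine ⟨⊤, SetLike.ext fun m => ?_⟩
    change (⊤ : ℕ∞) ≤ (m : ℕ∞) ↔ m ∈ A
    simp only [top_le_iff, ENat.natCast_ne_top, false_iff]
    exact fun hm => h ⟨m, hm⟩

theorem countable_sieve (p : ℕᵒᵈ) : Countable (Sieve p) := by
  have := countable_upperSet_nat
  refine Function.Injective.countable (f := fun R : Sieve p => (⟨{m | ∃ f : toDual m ⟶ p, R f},
    fun a b hab ⟨f, hf⟩ => ⟨homOfLE (toDual_le_toDual.2 hab) ≫ f, R.downward_closed hf _⟩⟩ :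
      UpperSet ℕ)) fun R R' h => ?_
  have key (q : ℕᵒᵈ) : (∃ f : q ⟶ p, R f) ↔ ∃ f : q ⟶ p, R' f :=
    Iff.of_eq (congrArg (fun A : UpperSet ℕ => ofDual q ∈ A) h)
  ext q f
  constructor
  · intro hf
    obtain ⟨g, hg⟩ := (key q).1 ⟨f, hf⟩
    rwa [Subsingleton.elim f g]
  · intro hf
    obtain ⟨g, hg⟩ := (key q).2 ⟨f, hf⟩
    rwa [Subsingleton.elim f g]

theorem gt_le : gt ℕᵒᵈ ≤ 2 ^ ℵ₀ := by
  have := countable_sieve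
  have : Countable (Σ p : ℕᵒᵈ, Sieve p) :=
    @instCountableSigma _ _ (inferInstanceAs (Countable ℕ)) _
  calc gt ℕᵒᵈ ≤ #(Set (Σ p : ℕᵒᵈ, Sieve p)) :=
        mk_le_of_injective (f := fun J => {x | x.2 ∈ J x.1}) fun J J' h => by
          ext p R
          exact Iff.of_eq (congrArg (fun A : Set (Σ p : ℕᵒᵈ, Sieve p) => ⟨p, R⟩ ∈ A) h)
    _ = 2 ^ #(Σ p : ℕᵒᵈ, Sieve p) := mk_set
    _ ≤ 2 ^ ℵ₀ := power_le_power_left two_ne_zero mk_le_aleph0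

/-- An injection of the sets of natural numbers into the infinite ones. -/
def oddOrHalf (A : Set ℕ) : Set ℕ := {m | Odd m ∨ m / 2 ∈ A}

theorem infinite_oddOrHalf (A : Set ℕ) : (oddOrHalf A).Infinite :=
  Set.infinite_of_injective_forall_mem (f := fun n => 2 * n + 1) (fun m n h => by simpa using h)
    fun n => .inl (odd_two_mul_add_one n)

theorem oddOrHalf_injective : Function.Injective oddOrHalf := by
  intro A B h
  ext n
  have key (A : Set ℕ) : 2 * n ∈ oddOrHalf A ↔ n ∈ A := by simp [oddOrHalf]
  rw [← key, ← key, h]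

theorem mk_subtype_grothendieckTopology {p : GrothendieckTopology ℕᵒᵈ → Prop}
    (hp : ∀ S : Set ℕ, S.Infinite → p (subsetTopology S)) : #{J // p J} = 2 ^ ℵ₀ := by
  refine le_antisymm ((mk_subtype_le p).trans gt_le) ?_
  calc 2 ^ ℵ₀ = #(Set ℕ) := by rw [mk_set, mk_nat]
    _ ≤ #{J // p J} := mk_le_of_injective
      (f := fun A => ⟨subsetTopology (oddOrHalf A), hp _ (infinite_oddOrHalf A)⟩) fun A B h =>
        oddOrHalf_injective (subsetTopology_injective (congrArg Subtype.val h))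

theorem gt_eq : gt ℕᵒᵈ = 2 ^ ℵ₀ :=
  gt_le.antisymm <|
    (mk_subtype_grothendieckTopology (p := fun _ => True) fun _ _ => trivial).symm.le.trans
      (mk_subtype_le _)

theorem ep_eq : ep ℕᵒᵈ = 2 ^ ℵ₀ :=
  mk_subtype_grothendieckTopology fun _ _ => inferInstance

theorem coh_eq : coh ℕᵒᵈ = 2 ^ ℵ₀ :=
  mk_subtype_grothendieckTopology fun _ hS => isCoherentSubtopos_subsetTopology hS

/-! ### Closed subtoposes -/

/-- An element of `U.obj p` is a map from the representable at `p`; inverting the projection lifts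
it uniquely to `F ⨯ U`, that is, singles out one element of `F.obj p`. -/
theorem isIso_prod_snd_iff {C : Type v} [SmallCategory C] (F U : Cᵒᵖ ⥤ Type v) :
    IsIso (prod.snd : F ⨯ U ⟶ U) ↔
      ∀ p, Nonempty (U.obj p) → Nonempty (Unique (F.obj p)) := by
  constructor
  · rintro hiso ⟨p⟩ ⟨u⟩
    have huniq (a : yoneda.obj p ⟶ F) :
        a = yonedaEquiv.symm u ≫ inv (prod.snd : F ⨯ U ⟶ U) ≫ prod.fst := by
      have : prod.lift a (yonedaEquiv.symm u) =
          yonedaEquiv.symm u ≫ inv (prod.snd : F ⨯ U ⟶ U) := by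
        rw [IsIso.eq_comp_inv, prod.lift_snd]
      rw [← Category.assoc, ← this, prod.lift_fst]
    refine ⟨⟨⟨yonedaEquiv (yonedaEquiv.symm u ≫ inv (prod.snd : F ⨯ U ⟶ U) ≫ prod.fst)⟩,
      fun x => ?_⟩⟩
    exact yonedaEquiv.symm_apply_eq.1 (huniq _)
  · intro h
    replace h (p : Cᵒᵖ) (hp : Nonempty (U.obj p)) : Unique (F.obj p) := (h p hp).some
    let φ : U ⟶ F :=
      { app p := ↾fun u => (h p ⟨u⟩).default
        naturality p q f := by
          ext u
          exact ((h q ⟨U.map f u⟩).uniq _).symm }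
    refine ⟨prod.lift φ (𝟙 U), ?_, prod.lift_snd _ _⟩
    refine prod.hom_ext ?_ (by
      rw [Category.assoc, prod.lift_snd, Category.comp_id, Category.id_comp])
    ext p x
    have u := (prod.snd : F ⨯ U ⟶ U).app p x
    exact ((h p ⟨u⟩).uniq _).trans ((h p ⟨u⟩).uniq _).symm

/-- The representable at `n` is supported on the numbers `≥ n`. There the empty sieve covers,
forcing singleton values; below `n` only the maximal sieve covers, so no condition arises. -/
theorem isClosedSubtopos_subsetTopology (n : ℕ) :
    IsClosedSubtopos (subsetTopology (Set.Iio n)) := by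
  refine ⟨yoneda.obj (toDual n), fun Z f g => ?_, fun F => ?_⟩
  · ext ⟨p⟩ x
    exact Subsingleton.elim (α := p ⟶ toDual n) _ _
  rw [isIso_prod_snd_iff]
  constructor
  · rintro hF ⟨p⟩ ⟨f⟩
    have hbot : ⊥ ∈ subsetTopology (Set.Iio n) p := fun q g hq =>
      absurd hq (not_lt.2 (show n ≤ ofDual q from (leOfHom g).trans (leOfHom f)))
    exact ⟨(Types.isTerminalEquivUnique _).1
      (Sheaf.isTerminalOfBotCover (⟨F, hF⟩ : Sheaf _ _) p hbot)⟩
  · intro h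
    rw [isSheaf_iff_isSheaf_of_type]
    intro p R hR
    by_cases hp : ofDual p < n
    · obtain rfl : R = ⊤ := (Sieve.id_mem_iff_eq_top).1 (hR (𝟙 p) hp)
      exact Presieve.isSheafFor_top _
    · have hu (q : ℕᵒᵈ) (f : q ⟶ p) : Nonempty (Unique (F.obj (op q))) :=
        h (op q) ⟨homOfLE (show n ≤ ofDual q from (not_lt.1 hp).trans (leOfHom f))⟩
      intro x hx
      obtain ⟨hup⟩ := hu p (𝟙 p)
      refine ⟨default, fun q f hf => ?_, fun y _ => hup.uniq y⟩
      obtain ⟨huq⟩ := hu q f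
      exact Subsingleton.elim _ _

theorem cl_eq : cl ℕᵒᵈ = ℵ₀ := by
  have := countable_upperSet_nat
  apply le_antisymm
  · rw [cl, mk_le_aleph0_iff]
    refine Function.Injective.countable
      (f := fun J : {J : GrothendieckTopology ℕᵒᵈ // IsClosedSubtopos J} =>
        (⟨{m | Nonempty (J.2.choose.obj (op (toDual m)))}, fun a b hab ⟨u⟩ =>
          ⟨transition _ hab u⟩⟩ : UpperSet ℕ)) fun J J' h => ?_
    have key (p : ℕᵒᵈᵒᵖ) : Nonempty (J.2.choose.obj p) ↔ Nonempty (J'.2.choose.obj p) :=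
      Iff.of_eq (congrArg (fun A : UpperSet ℕ => ofDual p.unop ∈ A) h)
    refine Subtype.ext (topology_eq_iff_same_sheaves.2 fun F => ?_)
    rw [← isSheaf_iff_isSheaf_of_type, ← isSheaf_iff_isSheaf_of_type, J.2.choose_spec.2,
      J'.2.choose_spec.2, isIso_prod_snd_iff, isIso_prod_snd_iff]
    simp only [key]
  · rw [← mk_nat]
    exact mk_le_of_injective
      (f := fun n => ⟨subsetTopology (Set.Iio n), isClosedSubtopos_subsetTopology n⟩) fun m n h =>
        Set.Iio_injective (subsetTopology_injective (congrArg Subtype.val h))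

end Cardinality

end PosetTopos

theorem mainTheorem10 :
    (∃ e : Order.PFilter ℕᵒᵈ ≃o ℕ∞,
      (∀ n : ℕ, e (Order.PFilter.principal (OrderDual.toDual n)) = (n : ℕ∞)) ∧
        (e.symm ⊤ : Set ℕᵒᵈ) = Set.univ) ∧
    #(Order.PFilter ℕᵒᵈ) = ℵ₀ ∧ #ℕᵒᵈ = ℵ₀ ∧ PosetTopos.cl ℕᵒᵈ = ℵ₀ ∧
    PosetTopos.gt ℕᵒᵈ = 2 ^ ℵ₀ ∧ PosetTopos.ep ℕᵒᵈ = 2 ^ ℵ₀ ∧ PosetTopos.coh ℕᵒᵈ = 2 ^ ℵ₀ ∧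
    SpectralSpace (Order.PFilter ℕᵒᵈ) ∧
    (∀ U : Set (Order.PFilter ℕᵒᵈ), IsOpen U → IsCompact U) ∧
    PosetTopos.patchTopology (Order.PFilter ℕᵒᵈ) =
      PosetTopos.strongTopology (Order.PFilter ℕᵒᵈ) := by
  refine ⟨⟨PosetTopos.filterOrderIso, fun n => ?_, PosetTopos.coe_filterOfENat_top⟩, ?_, mk_nat,
    PosetTopos.cl_eq, PosetTopos.gt_eq, PosetTopos.ep_eq, PosetTopos.coh_eq, inferInstance,
    fun _ => PosetTopos.isCompact_of_isOpen_filter, PosetTopos.patchTopology_filter⟩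
  · rw [← PosetTopos.filterOfENat_natCast, ← PosetTopos.filterOrderIso_symm_apply,
      OrderIso.apply_symm_apply]
  · rw [Cardinal.mk_congr PosetTopos.filterOrderIso.toEquiv]
    exact mk_eq_aleph0 ℕ∞
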